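/- Let $\mathbb{K}$ be a field, let $n\ge 1$, and let $G=C_{n,n}$ be the crown graph, i.e. the graph on the vertex set $\{x_1,\dots,x_n,y_1,\dots,y_n\}$ with edge set $\{\{x_i,y_j\} : 1\le i,j\le n,\ i\ne j\}$. Let $S=\mathbb{K}[x_1,\dots,x_n,y_1,\dots,y_n]$ with the standard grading, let $$J(G)=\Big(\prod_{v\in C} v \;:\; C \text{ is an inclusion-minimal vertex cover of } G\Big)\subseteq S$$ be the cover ideal of $G$, and let $\deg(J(G))=\max\{|C| : C\text{ is a minimal vertex cover of }G\}$. For a finitely generated graded $S$-module $M$ let $\operatorname{reg}(M)=\max\{j-i : \operatorname{Tor}_i^S(M,\mathbb{K})_j\neq 0\}$ be its Castelnuovo–Mumford regularity, and for an ideal $I\subseteq S$ let $I^{(s)}=\bigcap_{\mathfrak p\in\operatorname{Ass}(S/I)}(I^sS_{\mathfrak p}\cap S)$ be its $s$-th symbolic power. Then $\deg(J(G))=2n-2$, and for all $s\ge 1$, $$J(G)^{(s)}=J(G)^s\qquad\text{and}\qquad \operatorname{reg}(J(G)^s)=s\cdot\deg(J(G))=s(2n-2).$$ In other words, $\operatorname{reg}(J(G)^{(s)})=\operatorname{reg}(J(G)^s)=as+b$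 with $a=2n-2$ and $b=0$ for all $s\ge s_0=1$. -/

import Mathlib

open Finset

noncomputable section

section Koszul

variable {k σ : Type*} [Field k] [Fintype σ] [LinearOrder σ]
  {M : Type*} [AddCommGroup M] [Module (MvPolynomial σ k) M]

/-- The Koszul differential with coefficients in a module `M` over `S = k[x_v | v ∈ σ]`.
An element `∑ c(τ) ⊗ e_τ` of `M ⊗ ⋀ S^σ`, where `e_τ = e_{v₁} ∧ ⋯ ∧ e_{vᵢ}` for
`τ = {v₁ < ⋯ < vᵢ}`, is encoded by its coefficient function `c : Finset σ → M`, and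
`d (m ⊗ e_τ) = ∑ₗ (-1)^(l-1) x_{vₗ} m ⊗ e_{τ \ {vₗ}}`. -/
def koszulD : (Finset σ → M) →ₗ[MvPolynomial σ k] (Finset σ → M) where
  toFun c τ := ∑ v ∈ univ.filter (fun v => v ∉ τ),
    ((-1) ^ (τ.filter (fun w => w < v)).card * MvPolynomial.X v : MvPolynomial σ k) •
      c (insert v τ)
  map_add' c c' := by
    funext τ
    simp [smul_add, sum_add_distrib]
  map_smul' a c := by
    funext τ
    simp only [Pi.smul_apply, RingHom.id_apply, smul_sum]
    exact sum_congr rfl fun v _ => smul_comm _ _ _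

/-- The Koszul differential squares to zero. -/
theorem koszulD_koszulD (c : Finset σ → M) :
    koszulD (k := k) (koszulD (k := k) c) = 0 := by
  funext τ
  simp only [koszulD, LinearMap.coe_mk, AddHom.coe_mk, Pi.zero_apply, smul_sum, smul_smul]
  rw [sum_sigma']
  refine sum_involution (fun p _ => ⟨p.2, p.1⟩) ?_ ?_ ?_ ?_
  · rintro ⟨v, w⟩ h
    simp only [mem_sigma, mem_filter, mem_univ, true_and, mem_insert, not_or] at h
    obtain ⟨hv, hwv, hw⟩ := h
    have e : insert v (insert w τ) = insert w (insert v τ) := Finset.insert_comm _ _ _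
    simp only [filter_insert]
    rw [e, ← add_smul]
    rcases lt_or_gt_of_ne hwv with h | h
    · rw [if_neg (not_lt.2 h.le), if_pos h, card_insert_of_notMem (by simp [hw])]
      convert zero_smul (MvPolynomial σ k) (c (insert w (insert v τ))) using 2
      ring
    · rw [if_pos h, if_neg (not_lt.2 h.le), card_insert_of_notMem (by simp [hv])]
      convert zero_smul (MvPolynomial σ k) (c (insert w (insert v τ))) using 2
      ring
  · rintro ⟨v, w⟩ h _ he
    simp only [mem_sigma, mem_filter, mem_univ, true_and, mem_insert, not_or] at h
    simp only [Sigma.mk.injEq, heq_eq_eq] at he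
    exact h.2.1 he.1
  · rintro ⟨v, w⟩ h
    simp only [mem_sigma, mem_filter, mem_univ, true_and, mem_insert, not_or] at h ⊢
    exact ⟨h.2.2, fun e => h.2.1 e.symm, h.1⟩
  · intros
    rfl

variable [Module k M] [IsScalarTower k (MvPolynomial σ k) M]

/-- The part of internal degree `j` of the `i`-th term `M ⊗ ⋀ⁱ S^σ(-i)` of the Koszul complex
of a graded module `M = ⨁ ℳ d`; here every `e_τ` with `|τ| = i` has degree `i`. -/
def koszulChains (ℳ : ℤ → Submodule k M) (i : ℕ) (j : ℤ) : Submodule k (Finset σ → M) where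
  carrier := {c | ∀ τ : Finset σ, (τ.card = i → c τ ∈ ℳ (j - i)) ∧ (τ.card ≠ i → c τ = 0)}
  zero_mem' := fun τ => ⟨fun _ => zero_mem _, fun _ => rfl⟩
  add_mem' := fun {a b} ha hb τ =>
    ⟨fun h => add_mem ((ha τ).1 h) ((hb τ).1 h),
      fun h => by simp [(ha τ).2 h, (hb τ).2 h]⟩
  smul_mem' := fun r a ha τ =>
    ⟨fun h => Submodule.smul_mem _ r ((ha τ).1 h), fun h => by simp [(ha τ).2 h]⟩

/-- The cycles of the Koszul complex of `M` in homological degree `i` and internal degree `j`. -/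
def koszulCycles (ℳ : ℤ → Submodule k M) (i : ℕ) (j : ℤ) : Submodule k (Finset σ → M) :=
  koszulChains (σ := σ) ℳ i j ⊓ (LinearMap.ker (koszulD (k := k) (σ := σ) (M := M))).restrictScalars k

/-- The boundaries of the Koszul complex of `M` in homological degree `i` and internal
degree `j`. -/
def koszulBoundaries (ℳ : ℤ → Submodule k M) (i : ℕ) (j : ℤ) : Submodule k (Finset σ → M) :=
  (koszulChains (σ := σ) ℳ (i + 1) j).map
    ((koszulD (k := k) (σ := σ) (M := M)).restrictScalars k)

/-- If multiplication by the variables raises degrees by one, boundaries are cycles. -/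
theorem koszulBoundaries_le_koszulCycles (ℳ : ℤ → Submodule k M)
    (h : ∀ (v : σ) (d : ℤ), ∀ x ∈ ℳ d, (MvPolynomial.X v : MvPolynomial σ k) • x ∈ ℳ (d + 1))
    (i : ℕ) (j : ℤ) : koszulBoundaries (σ := σ) ℳ i j ≤ koszulCycles (σ := σ) ℳ i j := by
  rintro _ ⟨c, hc, rfl⟩
  refine ⟨fun τ => ⟨fun hτ => ?_, fun hτ => ?_⟩, koszulD_koszulD c⟩
  · refine sum_mem fun v hv => ?_
    have hv' : v ∉ τ := by simpa using hv
    have h1 := h v _ _ ((hc (insert v τ)).1 (by rw [card_insert_of_notMem hv', hτ]))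
    have h2 : j - ((i + 1 : ℕ) : ℤ) + 1 = j - i := by push_cast; ring
    rw [h2] at h1
    rw [mul_smul]
    rcases neg_one_pow_eq_or (MvPolynomial σ k) (τ.filter (fun w => w < v)).card with e | e
    · rw [e, one_smul]
      exact h1
    · rw [e, neg_smul, one_smul]
      exact neg_mem h1
  · refine sum_eq_zero fun v hv => ?_
    have hv' : v ∉ τ := by simpa using hv
    rw [(hc (insert v τ)).2 (by rw [card_insert_of_notMem hv']; omega), smul_zero]

/-- The graded component `Tor_i^S(M, k)_j`, where `k = S/(x_v | v ∈ σ)` and `M = ⨁ ℳ d` is a graded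
`S`-module. It is the homology of `M ⊗_S F`, where `F` is the Koszul complex on the variables,
the standard graded free resolution of `k` over the polynomial ring `S`. -/
abbrev GradedTor (ℳ : ℤ → Submodule k M) (i : ℕ) (j : ℤ) : Type _ :=
  koszulCycles (σ := σ) ℳ i j ⧸
    (koszulBoundaries (σ := σ) ℳ i j).submoduleOf (koszulCycles (σ := σ) ℳ i j)

/-- `r` is the Castelnuovo-Mumford regularity `max {j - i | Tor_i^S(M, k)_j ≠ 0}` of the graded
`S`-module `M = ⨁ ℳ d`; the maximum is required to exist. -/
def HasRegularity (ℳ : ℤ → Submodule k M) (r : ℤ) : Prop :=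
  IsGreatest {e : ℤ | ∃ (i : ℕ) (j : ℤ), Nontrivial (GradedTor (σ := σ) ℳ i j) ∧ e = j - i} r

end Koszul

/-- The standard grading of an ideal of a polynomial ring, as a graded module: the component of
degree `d` consists of the elements all of whose monomials have total degree `d`. -/
def idealGrading {k σ : Type*} [Field k] (I : Ideal (MvPolynomial σ k)) (d : ℤ) :
    Submodule k I where
  carrier := {f | ∀ m ∈ (f : MvPolynomial σ k).support, (m.degree : ℤ) = d}
  zero_mem' := by simp
  add_mem' := fun {a b} ha hb m hm => by
    classical
    rcases mem_union.1 (MvPolynomial.support_add hm) with h | h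
    · exact ha m h
    · exact hb m h
  smul_mem' := fun r a ha m hm => ha m (MvPolynomial.support_smul hm)

/-- The `s`-th symbolic power `⋂ (I^s R_𝔭 ∩ R)`, over the associated primes `𝔭` of `R/I`. -/
def symbolicPower {R : Type*} [CommRing R] (I : Ideal R) (s : ℕ) : Ideal R :=
  ⨅ (p : Ideal R) (hp : p ∈ associatedPrimes R (R ⧸ I)),
    haveI : p.IsPrime := hp.isPrime
    ((I ^ s).map (algebraMap R (Localization.AtPrime p))).comap
      (algebraMap R (Localization.AtPrime p))

/-- `C` is an inclusion-minimal vertex cover of `G`. -/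
def IsMinimalVertexCover {V : Type*} (G : SimpleGraph V) (C : Finset V) : Prop :=
  Minimal (fun D : Finset V => G.IsVertexCover (D : Set V)) C

/-- The cover ideal of `G`, generated by the products of the variables in the minimal vertex
covers of `G`. -/
def coverIdeal (k : Type*) [Field k] {V : Type*} (G : SimpleGraph V) :
    Ideal (MvPolynomial V k) :=
  Ideal.span {f | ∃ C : Finset V, IsMinimalVertexCover G C ∧ f = ∏ v ∈ C, MvPolynomial.X v}

/-- `deg J(G)`, the maximal cardinality of a minimal vertex cover of the finite graph `G`. -/
def coverDegree {V : Type*} (G : SimpleGraph V) : ℕ :=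
  sSup {c | ∃ C : Finset V, IsMinimalVertexCover G C ∧ c = C.card}

/-- The crown graph `C_{n,n}`: vertices `x_i = inlₗ i` and `y_j = inrₗ j`, and edges
`{x_i, y_j}` for `i ≠ j`. The vertices are ordered as `x_1 < ⋯ < x_n < y_1 < ⋯ < y_n`; the order
only fixes the signs in the Koszul complex. -/
def crownGraph (n : ℕ) : SimpleGraph (Fin n ⊕ₗ Fin n) where
  Adj u v := ∃ i j : Fin n, i ≠ j ∧
    ((u = Sum.inlₗ i ∧ v = Sum.inrₗ j) ∨ (v = Sum.inlₗ i ∧ u = Sum.inrₗ j))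
  symm := ⟨fun _ _ ⟨i, j, hij, h⟩ => ⟨i, j, hij, h.symm⟩⟩
  loopless := ⟨fun u ⟨_, _, _, h⟩ => by
    rcases h with ⟨h, h'⟩ | ⟨h, h'⟩ <;> exact Sum.inl_ne_inr (toLex.injective (h.symm.trans h'))⟩

end

/-! The crown graph is bipartite. For a bipartite graph `J(G) ^ s` is spanned by the monomials whose
exponents sum to at least `s` on every edge: any such exponent vector dominates a sum of `s` vertex
covers, its level sets (`monomial_mem_coverIdeal_pow`). The edge condition is membership in the
`s`-th power of the edge prime `(x_u, x_v)`, and edge primes are associated to `J(G)`, so symbolic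
and ordinary powers agree.

For the regularity, `Tor_i` in multidegree `γ` is the reduced homology in degree `i - 1` of the
upper Koszul complex of `γ`. By `isAcyclicAt_crown` it vanishes once `|γ| > (2n-2)s + i`. Either the
complex has no faces, or it is a cone over a free vertex, or all weights are at most `s` and every
vertex has an edge of weight at most `s + 1`. In the last case two disjoint such edges give `|γ| ≤
(2n-4)s + 2(s+1) = (2n-2)s + 2`, which leaves `i = 0` and `i = 1`. There a failure of nonemptiness,
respectively connectedness, makes two, respectively one, of the disjoint edges lighter by one, and
the degree bound fails.

The value `s(2n-2)` is attained in `Tor_0` by the `s`-th power of the product over the largest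
minimal cover, the complement of `{x_i, y_i}`. -/

open Finset

/-! ### Powers and symbolic powers of cover ideals of bipartite graphs -/

section SymbolicPowers

variable {k V : Type*} [Field k]

/-- Exponent vectors giving every edge a total weight of at least `s`. -/
def IsCoverExponent (G : SimpleGraph V) (s : ℕ) (m : V →₀ ℕ) : Prop :=
  ∀ ⦃u v⦄, G.Adj u v → s ≤ m u + m v

open Classical in
/-- The substitution multiplying the variables of two vertices by a new variable. -/
noncomputable def edgeScaling (k : Type*) [Field k] {V : Type*} (u v : V) :
    MvPolynomial V k →ₐ[k] Polynomial (MvPolynomial V k) :=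
  MvPolynomial.aeval fun w =>
    if w = u ∨ w = v then Polynomial.C (MvPolynomial.X w) * Polynomial.X
    else Polynomial.C (MvPolynomial.X w)

theorem edgeScaling_monomial {u v : V} (huv : u ≠ v) (m : V →₀ ℕ) (a : k) :
    edgeScaling k u v (MvPolynomial.monomial m a) =
      Polynomial.monomial (m u + m v) (MvPolynomial.monomial m a) := by
  classical
  have key : ∀ w, ((if w = u ∨ w = v then
      Polynomial.C (MvPolynomial.X w : MvPolynomial V k) * Polynomial.X
      else Polynomial.C (MvPolynomial.X w)) : Polynomial (MvPolynomial V k)) =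
      Polynomial.C (MvPolynomial.X w) * Polynomial.X ^ (if w = u ∨ w = v then 1 else 0) := by
    intro w
    split_ifs <;> simp
  have hsum : (m.sum fun w e => (if w = u ∨ w = v then 1 else 0) * e) = m u + m v := by
    have h1 : ∀ w, (if w = u ∨ w = v then 1 else 0) * m w =
        (if w = u then m u else 0) + (if w = v then m v else 0) := by
      intro w
      by_cases h : w = u
      · subst h; simp [huv]
      · by_cases h' : w = v
        · subst h'; simp [h]
        · simp [h, h']
    rw [Finsupp.sum, sum_congr rfl fun w _ => h1 w, sum_add_distrib, sum_ite_eq', sum_ite_eq']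
    congr 1 <;> (split_ifs with h; rfl; simpa [eq_comm] using h)
  rw [edgeScaling, MvPolynomial.aeval_monomial]
  simp only [key, mul_pow, ← pow_mul]
  rw [Finsupp.prod_mul]
  have h2 : (m.prod fun w e => (Polynomial.X : Polynomial (MvPolynomial V k)) ^
      ((if w = u ∨ w = v then 1 else 0) * e)) = Polynomial.X ^ (m u + m v) := by
    rw [← hsum, Finsupp.prod, Finsupp.sum, prod_pow_eq_pow_sum]
  rw [h2, ← Polynomial.C_mul_X_pow_eq_monomial, MvPolynomial.monomial_eq, map_mul, Finsupp.prod,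
    Finsupp.prod, map_prod, mul_assoc]
  simp only [map_pow]
  rfl

theorem coeff_edgeScaling {u v : V} (huv : u ≠ v) (f : MvPolynomial V k) (d : ℕ) (m : V →₀ ℕ) :
    ((edgeScaling k u v f).coeff d).coeff m = if m u + m v = d then f.coeff m else 0 := by
  classical
  induction f using MvPolynomial.induction_on' with
  | monomial m' a =>
    rw [edgeScaling_monomial huv, Polynomial.coeff_monomial, MvPolynomial.coeff_monomial]
    by_cases h : m' = m
    · subst h
      split_ifs <;> simp_all
    · rw [if_neg h]
      split_ifs <;> simp [MvPolynomial.coeff_monomial, h]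
  | add p q hp hq =>
    rw [map_add, Polynomial.coeff_add, MvPolynomial.coeff_add, hp, hq, MvPolynomial.coeff_add]
    split_ifs <;> simp

/-- The power of the new variable records the degree of a monomial in `x_u` and `x_v`, so
divisibility by `X ^ s` detects the `s`-th power of the edge prime through order of vanishing. -/
theorem X_pow_dvd_edgeScaling_iff {u v : V} (huv : u ≠ v) (f : MvPolynomial V k) (s : ℕ) :
    Polynomial.X ^ s ∣ edgeScaling k u v f ↔ ∀ m ∈ f.support, s ≤ m u + m v := by
  rw [Polynomial.X_pow_dvd_iff]
  constructor
  · intro h m hm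
    by_contra! hlt
    have := congrArg (MvPolynomial.coeff m) (h _ hlt)
    rw [coeff_edgeScaling huv, if_pos rfl, MvPolynomial.coeff_zero] at this
    exact MvPolynomial.mem_support_iff.1 hm this
  · intro h d hd
    ext m
    rw [coeff_edgeScaling huv, MvPolynomial.coeff_zero]
    split_ifs with hm
    · by_contra hne
      exact absurd (h m (MvPolynomial.mem_support_iff.2 hne)) (by omega)
    · rfl

/-- The prime ideal generated by the variables of two vertices. -/
noncomputable def edgePrime (k : Type*) [Field k] {V : Type*} (u v : V) :
    Ideal (MvPolynomial V k) :=
  (Ideal.span {Polynomial.X}).comap (edgeScaling k u v)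

theorem mem_edgePrime {u v : V} (f : MvPolynomial V k) :
    f ∈ edgePrime k u v ↔ Polynomial.X ∣ edgeScaling k u v f := by
  rw [edgePrime, Ideal.mem_comap, Ideal.mem_span_singleton]

instance edgePrime_isPrime (u v : V) : (edgePrime k u v).IsPrime := by
  have : (Ideal.span {(Polynomial.X : Polynomial (MvPolynomial V k))}).IsPrime :=
    (Ideal.span_singleton_prime Polynomial.X_ne_zero).2 Polynomial.prime_X
  exact Ideal.IsPrime.comap _

theorem coverIdeal_le_edgePrime {G : SimpleGraph V} {u v : V} (h : G.Adj u v) :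
    coverIdeal k G ≤ edgePrime k u v := by
  rw [coverIdeal, Ideal.span_le]
  rintro _ ⟨C, hC, rfl⟩
  have hX : ∀ w, w = u ∨ w = v → (MvPolynomial.X w : MvPolynomial V k) ∈ edgePrime k u v := by
    intro w hw
    rw [mem_edgePrime, edgeScaling, MvPolynomial.aeval_X, if_pos hw]
    exact dvd_mul_left _ _
  rcases hC.prop h with hu | hv
  · exact Ideal.mem_of_dvd _ (dvd_prod_of_mem _ (mem_coe.1 hu)) (hX u (Or.inl rfl))
  · exact Ideal.mem_of_dvd _ (dvd_prod_of_mem _ (mem_coe.1 hv)) (hX v (Or.inr rfl))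

theorem X_pow_dvd_edgeScaling_of_mem {G : SimpleGraph V} {u v : V} (h : G.Adj u v) {s : ℕ}
    {f : MvPolynomial V k} (hf : f ∈ coverIdeal k G ^ s) :
    Polynomial.X ^ s ∣ edgeScaling k u v f := by
  have h1 := Ideal.pow_right_mono (coverIdeal_le_edgePrime (k := k) h) s hf
  have h2 := Ideal.le_comap_pow (edgeScaling k u v)
    (K := Ideal.span {(Polynomial.X : Polynomial (MvPolynomial V k))}) s h1
  rwa [Ideal.mem_comap, Ideal.span_singleton_pow, Ideal.mem_span_singleton] at h2

theorem isCoverExponent_of_mem {G : SimpleGraph V} {s : ℕ} {f : MvPolynomial V k}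
    (hf : f ∈ coverIdeal k G ^ s) {m : V →₀ ℕ} (hm : m ∈ f.support) : IsCoverExponent G s m :=
  fun _ _ h => (X_pow_dvd_edgeScaling_iff h.ne f s).1 (X_pow_dvd_edgeScaling_of_mem h hf) m hm

theorem prod_X_mem_coverIdeal {G : SimpleGraph V} {C : Finset V}
    (hC : G.IsVertexCover (C : Set V)) :
    (∏ v ∈ C, MvPolynomial.X v : MvPolynomial V k) ∈ coverIdeal k G := by
  obtain ⟨D, hDC, hD⟩ := exists_minimal_le_of_wellFoundedLT
    (fun D : Finset V => G.IsVertexCover (D : Set V)) C hC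
  exact Ideal.mem_of_dvd _ (prod_dvd_prod_of_subset _ _ _ hDC) (Ideal.subset_span ⟨D, hD, rfl⟩)

/-- For a bipartite graph the exponent vector of an `s`-cover is a sum of `s` vertex covers, cut
out by its level sets. -/
theorem monomial_mem_coverIdeal_pow [Fintype V] {G : SimpleGraph V} (col : G.Coloring Bool)
    {s : ℕ} {m : V →₀ ℕ} (hm : IsCoverExponent G s m) (a : k) :
    MvPolynomial.monomial m a ∈ coverIdeal k G ^ s := by
  classical
  let C : ℕ → Finset V := fun t => univ.filter fun v =>
    if col v then t < m v else s ≤ m v + t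
  -- On an edge with ends `u` of colour `true` and `v` of colour `false`, if `m u ≤ t` then `m v ≥ s
  -- - m u ≥ s - t`, so `v` lies in `C t`.
  have hC : ∀ t, G.IsVertexCover (C t : Set V) := by
    intro t u v huv
    have h1 := hm huv
    have h2 := col.valid huv
    simp only [C, coe_filter, mem_univ, true_and, Set.mem_ofPred_eq]
    cases hu : col u <;> cases hv : col v <;> simp_all <;> omega
  -- Each vertex `v` lies in `min (m v) s` of the first `s` levels, whichever its colour.
  have hle : ∀ v, ∑ t ∈ range s, (if v ∈ C t then 1 else 0) ≤ m v := by
    intro v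
    rw [sum_boole, Nat.cast_id]
    simp only [C, mem_filter, mem_univ, true_and]
    split_ifs with hv
    · calc _ ≤ (range (m v)).card := card_le_card fun t ht => by
            simp only [mem_filter, mem_range] at ht ⊢; exact ht.2
        _ = m v := card_range _
    · calc _ ≤ (Ico (s - m v) s).card := card_le_card fun t ht => by
            simp only [mem_filter, mem_range, mem_Ico] at ht ⊢; omega
        _ ≤ m v := by rw [Nat.card_Ico]; omega
  have hdvd : (∏ t ∈ range s, ∏ v ∈ C t, MvPolynomial.X v : MvPolynomial V k) ∣
      MvPolynomial.monomial m a := by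
    have e : (∏ t ∈ range s, ∏ v ∈ C t, MvPolynomial.X v : MvPolynomial V k) =
        ∏ v, MvPolynomial.X v ^ ∑ t ∈ range s, (if v ∈ C t then 1 else 0) := by
      simp only [← prod_pow_eq_pow_sum]
      rw [prod_comm]
      refine prod_congr rfl fun t _ => ?_
      simp only [pow_ite, pow_one, pow_zero]
      rw [prod_ite_mem, univ_inter]
    rw [e, MvPolynomial.monomial_eq, Finsupp.prod_fintype _ _ (by simp)]
    exact Dvd.dvd.mul_left (prod_dvd_prod_of_dvd _ _ fun v _ => pow_dvd_pow _ (hle v)) _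
  refine Ideal.mem_of_dvd _ hdvd ?_
  have := Ideal.prod_mem_prod (s := range s) (I := fun _ => coverIdeal k G)
    (x := fun t => (∏ v ∈ C t, MvPolynomial.X v : MvPolynomial V k))
    fun t _ => prod_X_mem_coverIdeal (hC t)
  simpa using this

theorem mem_coverIdeal_pow_iff [Fintype V] {G : SimpleGraph V} (col : G.Coloring Bool)
    {s : ℕ} {f : MvPolynomial V k} :
    f ∈ coverIdeal k G ^ s ↔ ∀ m ∈ f.support, IsCoverExponent G s m := by
  refine ⟨fun hf m hm => isCoverExponent_of_mem hf hm, fun h => ?_⟩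
  rw [MvPolynomial.as_sum f]
  exact sum_mem fun m hm => monomial_mem_coverIdeal_pow col (h m hm) _

/-- The edge prime is the annihilator of the class of the product `w` of all variables other than
`x_u`, `x_v`: multiplying `w` by either of these gives a cover, since every other edge already meets
`w`. -/
theorem edgePrime_mem_associatedPrimes [Fintype V] {G : SimpleGraph V} (col : G.Coloring Bool)
    {u v : V} (huv : G.Adj u v) :
    edgePrime k u v ∈
      associatedPrimes (MvPolynomial V k) (MvPolynomial V k ⧸ coverIdeal k G) := by
  classical
  let e : V →₀ ℕ := Finsupp.equivFunOnFinite.symm fun w => if w = u ∨ w = v then 0 else 1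
  have he : ∀ w, e w = if w = u ∨ w = v then 0 else 1 := fun w => rfl
  let w : MvPolynomial V k := MvPolynomial.monomial e 1
  have hw : w ∉ edgePrime k u v := by
    rw [mem_edgePrime, ← pow_one Polynomial.X, X_pow_dvd_edgeScaling_iff huv.ne]
    intro h
    have := h e (by simp [w, MvPolynomial.support_monomial])
    simp [he] at this
  have key : edgePrime k u v =
      (⊥ : Submodule (MvPolynomial V k) (MvPolynomial V k ⧸ coverIdeal k G)).colon
        {Ideal.Quotient.mk _ w} := by
    ext f
    rw [Submodule.mem_colon_singleton, Submodule.mem_bot, ← Ideal.Quotient.mk_eq_mk,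
      ← Submodule.Quotient.mk_smul, Ideal.Quotient.mk_eq_mk, Ideal.Quotient.eq_zero_iff_mem,
      smul_eq_mul]
    constructor
    · intro hf
      rw [mem_edgePrime, ← pow_one Polynomial.X, X_pow_dvd_edgeScaling_iff huv.ne] at hf
      rw [← pow_one (coverIdeal k G), mem_coverIdeal_pow_iff col]
      intro m hm a b hab
      rw [MvPolynomial.mem_support_iff, MvPolynomial.coeff_mul_monomial'] at hm
      split_ifs at hm with hle
      · have h1 := hf (m - e) (MvPolynomial.mem_support_iff.2 (by simpa using hm))
        simp only [Finsupp.coe_tsub, Pi.sub_apply, he] at h1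
        have h2 := hle a
        have h3 := hle b
        rw [he] at h2 h3
        have := hab.ne
        by_cases ha : a = u ∨ a = v
        · by_cases hb : b = u ∨ b = v
          · rcases ha with rfl | rfl <;> rcases hb with rfl | rfl <;> simp_all; omega
          · rw [if_neg hb] at h3; omega
        · rw [if_neg ha] at h2; omega
      · exact absurd rfl hm
    · intro hf
      exact ((edgePrime_isPrime u v).mem_or_mem (coverIdeal_le_edgePrime huv hf)).resolve_right hw
  refine ⟨edgePrime_isPrime u v, Ideal.Quotient.mk _ w, ?_⟩
  rw [← key, (edgePrime_isPrime u v).radical]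

/-- Symbolic and ordinary powers of the cover ideal of a bipartite graph agree. -/
theorem symbolicPower_coverIdeal [Fintype V] {G : SimpleGraph V} (col : G.Coloring Bool) (s : ℕ) :
    symbolicPower (coverIdeal k G) s = coverIdeal k G ^ s := by
  apply le_antisymm
  · intro f hf
    rw [mem_coverIdeal_pow_iff col]
    intro m hm u v huv
    simp only [symbolicPower, Ideal.mem_iInf] at hf
    have h1 := hf _ (edgePrime_mem_associatedPrimes col huv)
    rw [Ideal.mem_comap,
      -- Some `g` outside the edge prime has `g * f ∈ J ^ s`. As `X` is prime and does not divide
      -- the image of `g`, all of `X ^ s` divides the image of `f`.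
      IsLocalization.algebraMap_mem_map_algebraMap_iff (edgePrime k u v).primeCompl] at h1
    obtain ⟨g, hg, hgf⟩ := h1
    have h2 := X_pow_dvd_edgeScaling_of_mem huv hgf
    rw [map_mul] at h2
    have h3 := Polynomial.prime_X.pow_dvd_of_dvd_mul_left s
      (fun h => hg ((mem_edgePrime g).2 h)) h2
    exact (X_pow_dvd_edgeScaling_iff huv.ne f s).1 h3 m hm
  · exact le_iInf₂ fun p hp => Ideal.le_comap_map

end SymbolicPowers

/-! ### Acyclicity criteria for simplicial complexes -/

section SimplicialChains

variable {k σ : Type*} [Field k] [Fintype σ] [LinearOrder σ]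

/-- The simplicial boundary map, chains being encoded by their coefficient functions. -/
def simplicialD (k : Type*) {σ : Type*} [Field k] [Fintype σ] [LinearOrder σ] :
    (Finset σ → k) →ₗ[k] (Finset σ → k) where
  toFun c τ := ∑ v ∈ univ.filter (fun v => v ∉ τ),
    (-1) ^ (τ.filter (fun w => w < v)).card * c (insert v τ)
  map_add' c c' := by
    funext τ
    simp [mul_add, sum_add_distrib]
  map_smul' a c := by
    funext τ
    simp only [Pi.smul_apply, RingHom.id_apply, smul_eq_mul, mul_sum]
    exact sum_congr rfl fun v _ => by ring

theorem simplicialD_apply (c : Finset σ → k) (τ : Finset σ) :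
    simplicialD k c τ = ∑ v ∈ univ.filter (fun v => v ∉ τ),
      (-1) ^ (τ.filter (fun w => w < v)).card * c (insert v τ) := rfl

/-- The chains supported on the faces with `i` elements of a family `F`. -/
def simplicialChains (k : Type*) {σ : Type*} [Field k] (F : Finset σ → Prop) (i : ℕ) :
    Submodule k (Finset σ → k) where
  carrier := {c | ∀ τ, c τ ≠ 0 → F τ ∧ τ.card = i}
  zero_mem' := by simp
  add_mem' := fun {a b} ha hb τ h => by
    by_cases h' : a τ = 0
    · exact hb τ fun h0 => h (by simp [h', h0])
    · exact ha τ h'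
  smul_mem' := fun r a ha τ h => ha τ fun h0 => h (by simp [h0])

/-- Every cycle supported on the faces with `i` elements is a boundary. -/
def IsAcyclicAt (k : Type*) {σ : Type*} [Field k] [Fintype σ] [LinearOrder σ]
    (F : Finset σ → Prop) (i : ℕ) : Prop :=
  ∀ c ∈ simplicialChains k F i, simplicialD k c = 0 →
    ∃ b ∈ simplicialChains k F (i + 1), simplicialD k b = c

theorem simplicialD_single (ρ : Finset σ) :
    simplicialD k (Pi.single ρ 1) =
      ∑ v ∈ ρ, Pi.single (ρ.erase v) ((-1) ^ ((ρ.erase v).filter (fun w => w < v)).card) := by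
  funext τ
  rw [simplicialD_apply, Finset.sum_apply, sum_filter, ← sum_filter_add_sum_filter_not univ
    (fun v => v ∈ ρ), sum_eq_zero (s := univ.filter fun v => v ∉ ρ), add_zero]
  · rw [filter_mem_eq_inter, univ_inter]
    refine sum_congr rfl fun v hv => ?_
    by_cases h : τ = ρ.erase v
    · subst h
      simp [insert_erase hv]
    · rw [Pi.single_eq_of_ne h]
      split_ifs with hvτ
      · rfl
      · rw [Pi.single_eq_of_ne, mul_zero]
        rintro rfl
        exact h (erase_insert hvτ).symm
  · intro v hv
    split_ifs with hvτ
    · rfl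
    · rw [Pi.single_eq_of_ne, mul_zero]
      rintro rfl
      simp at hv

theorem sign_insert_mul_sign_insert {k σ : Type*} [Field k] [LinearOrder σ] {ρ : Finset σ} {u v : σ} (hu : u ∉ ρ) (hv : v ∉ ρ)
    (huv : u ≠ v) :
    (-1 : k) ^ ((insert v ρ).filter (fun w => w < u)).card *
        (-1) ^ ((insert u ρ).filter (fun w => w < v)).card =
      -((-1) ^ (ρ.filter (fun w => w < u)).card * (-1) ^ (ρ.filter (fun w => w < v)).card) := by
  rcases lt_or_gt_of_ne huv with h | h
  · rw [filter_insert, if_neg (not_lt.2 h.le), filter_insert, if_pos h,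
      card_insert_of_notMem (by simp [hu])]
    ring
  · rw [filter_insert, if_pos h, filter_insert, if_neg (not_lt.2 h.le),
      card_insert_of_notMem (by simp [hv])]
    ring

/-- A cone is acyclic. -/
theorem isAcyclicAt_of_cone {F : Finset σ → Prop} (v : σ) (hF : ∀ τ, F τ → F (insert v τ))
    (i : ℕ) : IsAcyclicAt k F i := by
  intro c hc hdc
  -- The bounding chain is the cone `v ∧ c`, whose sign is that of moving `v` into its place.
  refine ⟨fun τ => if v ∈ τ then
    (-1) ^ ((τ.erase v).filter (fun w => w < v)).card * c (τ.erase v) else 0, ?_, ?_⟩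
  · intro τ hτ
    by_cases hv : v ∈ τ
    · simp only [hv, if_true] at hτ
      obtain ⟨h1, h2⟩ := hc _ (right_ne_zero_of_mul hτ)
      have h3 := hF _ h1
      rw [insert_erase hv] at h3
      refine ⟨h3, ?_⟩
      rw [card_erase_of_mem hv] at h2
      have := card_pos.2 ⟨v, hv⟩
      omega
    · simp [hv] at hτ
  · funext τ
    rw [simplicialD_apply]
    -- For `τ = insert v ρ` the cycle condition at `ρ` recovers `c τ`; for `v ∉ τ` only the term of
    -- `v` survives, and its two signs cancel.
    by_cases hv : v ∈ τ
    · obtain ⟨ρ, hvρ, rfl⟩ : ∃ ρ, v ∉ ρ ∧ τ = insert v ρ :=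
        ⟨τ.erase v, by simp, (insert_erase hv).symm⟩
      have h0 := congrFun hdc ρ
      rw [simplicialD_apply, Pi.zero_apply] at h0
      have hs : univ.filter (fun u => u ∉ ρ) = insert v (univ.filter fun u => u ∉ insert v ρ) := by
        ext u
        by_cases h : u = v
        · subst h; simp [hvρ]
        · simp [h]
      rw [hs, sum_insert (by simp)] at h0
      have hsq : ((-1 : k) ^ (ρ.filter (fun w => w < v)).card) *
          (-1) ^ (ρ.filter (fun w => w < v)).card = 1 := by
        rw [← mul_pow]; simp
      have h1 : c (insert v ρ) = -∑ u ∈ univ.filter (fun u => u ∉ insert v ρ),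
          (-1) ^ (ρ.filter (fun w => w < v)).card *
            ((-1) ^ (ρ.filter (fun w => w < u)).card * c (insert u ρ)) := by
        rw [← mul_sum]
        linear_combination (-1) ^ (ρ.filter (fun w => w < v)).card * h0 - c (insert v ρ) * hsq
      rw [h1, ← sum_neg_distrib]
      refine sum_congr rfl fun u hu => ?_
      simp only [mem_filter, mem_univ, true_and, mem_insert, not_or] at hu
      have he : (insert u (insert v ρ)).erase v = insert u ρ := by
        rw [insert_comm, erase_insert]
        simp [hvρ, Ne.symm hu.1]
      rw [if_pos (by simp), he, ← mul_assoc,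
        sign_insert_mul_sign_insert hu.2 hvρ hu.1]
      ring
    · rw [sum_eq_single v]
      · rw [if_pos (mem_insert_self _ _), erase_insert hv,
          ← mul_assoc, ← mul_pow]
        simp
      · intro u _ huv
        rw [if_neg (by simp [hv, Ne.symm huv]), mul_zero]
      · intro h
        simp [hv] at h

/-- A complex with a vertex has no reduced homology in degree `-1`. -/
theorem isAcyclicAt_zero {F : Finset σ → Prop} {v : σ} (hv : F {v}) : IsAcyclicAt k F 0 := by
  intro c hc _
  refine ⟨c ∅ • Pi.single {v} 1, fun τ hτ => ?_, ?_⟩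
  · have : τ = {v} := by
      by_contra h
      simp [h] at hτ
    subst this
    exact ⟨hv, by simp⟩
  · rw [map_smul, simplicialD_single, sum_singleton]
    funext τ
    by_cases h : τ = ∅
    · subst h; simp
    · have : c τ = 0 := by
        by_contra h0
        exact h (card_eq_zero.1 (hc τ h0).2)
      simp [h, this]

/-- A connected complex has no reduced homology in degree `0`. -/
theorem isAcyclicAt_one {F : Finset σ → Prop}
    (hF : ∀ u w, F {u} → F {w} → Relation.ReflTransGen (fun a b => F {a, b}) u w) :
    IsAcyclicAt k F 1 := by
  intro c hc hdc
  let B : Submodule k (Finset σ → k) := (simplicialChains k F 2).map (simplicialD k)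
  suffices c ∈ B from this
  have hlt : ∀ a b, a < b → F {a, b} →
      (Pi.single {b} 1 - Pi.single {a} 1 : Finset σ → k) ∈ B := by
    intro a b hab h
    refine ⟨Pi.single {a, b} 1, fun τ hτ => ?_, ?_⟩
    · have : τ = {a, b} := by
        by_contra h
        simp [h] at hτ
      subst this
      exact ⟨h, card_pair hab.ne⟩
    · have e1 : ({a, b} : Finset σ).erase a = {b} := by
        rw [erase_insert]; simpa using hab.ne
      have e2 : ({a, b} : Finset σ).erase b = {a} := by
        rw [pair_comm, erase_insert]; simpa using hab.ne'
      rw [simplicialD_single, sum_pair hab.ne, e1, e2, filter_singleton, filter_singleton,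
        if_neg (not_lt.2 hab.le), if_pos hab, sub_eq_add_neg, ← Pi.single_neg]
      simp
  have hstep : ∀ a b, F {a, b} → (Pi.single {b} 1 - Pi.single {a} 1 : Finset σ → k) ∈ B := by
    intro a b h
    rcases lt_trichotomy a b with hab | rfl | hab
    · exact hlt a b hab h
    · simp
    · rw [← neg_sub]
      exact neg_mem (hlt b a hab (by rwa [pair_comm]))
  have hpath : ∀ a b, Relation.ReflTransGen (fun a b => F {a, b}) a b →
      (Pi.single {b} 1 - Pi.single {a} 1 : Finset σ → k) ∈ B := by
    intro a b h
    induction h with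
    | refl => simp
    | tail _ h ih =>
      have := add_mem (hstep _ _ h) ih
      rwa [sub_add_sub_cancel] at this
  -- A 0-cycle has coefficient sum zero, hence is a combination of differences of points with a
  -- fixed base vertex, each bounded by a path.
  have hsum : c = ∑ u, c {u} • (Pi.single {u} 1 : Finset σ → k) := by
    funext τ
    rw [Finset.sum_apply]
    by_cases h : τ.card = 1
    · obtain ⟨w, rfl⟩ := card_eq_one.1 h
      simp [Pi.single_apply]
    · have h0 : c τ = 0 := by
        by_contra h0
        exact h (hc τ h0).2
      rw [h0, sum_eq_zero]
      intro u _
      rw [Pi.smul_apply, Pi.single_eq_of_ne, smul_zero]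
      rintro rfl
      simp at h
  have htot : ∑ u, c {u} = 0 := by
    have := congrFun hdc ∅
    rw [simplicialD_apply] at this
    simpa using this
  by_cases hw : ∃ w, F {w}
  · obtain ⟨w, hw⟩ := hw
    have h1 : c = ∑ u, c {u} • (Pi.single {u} 1 - Pi.single {w} 1 : Finset σ → k) := by
      simp only [smul_sub, sum_sub_distrib]
      rw [← hsum, ← sum_smul, htot, zero_smul, sub_zero]
    rw [h1]
    refine sum_mem fun u _ => ?_
    by_cases hu : c {u} = 0
    · simp [hu]
    · exact Submodule.smul_mem _ _ (hpath _ _ (hF _ _ hw (hc _ hu).1))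
  · rw [hsum]
    refine sum_mem fun u _ => ?_
    have : c {u} = 0 := by
      by_contra h
      exact hw ⟨u, (hc _ h).1⟩
    simp [this]

end SimplicialChains

/-! ### Multigraded Koszul homology of monomial ideals -/

section MonomialIdeals

variable {k σ : Type*} [Field k] [Fintype σ] [LinearOrder σ]

/-- The exponent vector of a squarefree monomial. -/
noncomputable def faceExponent {σ : Type*} [Fintype σ] [DecidableEq σ] (τ : Finset σ) : σ →₀ ℕ :=
  Finsupp.equivFunOnFinite.symm fun v => if v ∈ τ then 1 else 0

theorem faceExponent_apply {σ : Type*} [Fintype σ] [DecidableEq σ] (τ : Finset σ) (v : σ) :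
    faceExponent τ v = if v ∈ τ then 1 else 0 := rfl

theorem degree_faceExponent {σ : Type*} [Fintype σ] [DecidableEq σ] (τ : Finset σ) :
    (faceExponent τ).degree = τ.card := by
  rw [Finsupp.degree_eq_sum]
  simp [faceExponent_apply]

theorem faceExponent_insert {σ : Type*} [Fintype σ] [DecidableEq σ] {τ : Finset σ} {v : σ}
    (hv : v ∉ τ) : faceExponent (insert v τ) = faceExponent τ + Finsupp.single v 1 := by
  ext w
  rw [Finsupp.add_apply, faceExponent_apply, faceExponent_apply, Finsupp.single_apply]
  by_cases h : v = w
  · subst h; simp [hv]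
  · simp [h, Ne.symm h]

/-- The upper Koszul complex in multidegree `γ` of the monomial ideal whose monomials have
exponents satisfying `Q`. -/
def IsKoszulFace {σ : Type*} [Fintype σ] [DecidableEq σ] (Q : (σ →₀ ℕ) → Prop) (γ : σ →₀ ℕ)
    (τ : Finset σ) : Prop :=
  faceExponent τ ≤ γ ∧ Q (γ - faceExponent τ)

variable {I : Ideal (MvPolynomial σ k)} {Q : (σ →₀ ℕ) → Prop}

open Classical in
/-- The chain of multidegree `γ` with coefficients `c`. -/
noncomputable def multigradedChain (hI : ∀ f, f ∈ I ↔ ∀ m ∈ f.support, Q m) (γ : σ →₀ ℕ) (c : Finset σ → k)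
    (τ : Finset σ) : I :=
  if h : IsKoszulFace Q γ τ then
    ⟨MvPolynomial.monomial (γ - faceExponent τ) (c τ), (hI _).2 fun m hm => by
      rw [mem_singleton.1 (MvPolynomial.support_monomial_subset hm)]
      exact h.2⟩
  else 0

theorem multigradedChain_of_face (hI : ∀ f, f ∈ I ↔ ∀ m ∈ f.support, Q m) {γ : σ →₀ ℕ}
    (c : Finset σ → k) {τ : Finset σ} (h : IsKoszulFace Q γ τ) :
    (multigradedChain hI γ c τ : MvPolynomial σ k) =
      MvPolynomial.monomial (γ - faceExponent τ) (c τ) := by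
  rw [multigradedChain, dif_pos h]

theorem multigradedChain_of_not_face (hI : ∀ f, f ∈ I ↔ ∀ m ∈ f.support, Q m) {γ : σ →₀ ℕ}
    (c : Finset σ → k) {τ : Finset σ} (h : ¬IsKoszulFace Q γ τ) :
    multigradedChain hI γ c τ = 0 := by
  rw [multigradedChain, dif_neg h]

theorem coe_koszulD (z : Finset σ → I) (τ : Finset σ) :
    ((koszulD (k := k) z τ : I) : MvPolynomial σ k) =
      ∑ v ∈ univ.filter (fun v => v ∉ τ),
        MvPolynomial.C ((-1) ^ (τ.filter (fun w => w < v)).card) *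
          (MvPolynomial.X v * (z (insert v τ) : MvPolynomial σ k)) := by
  simp only [koszulD, LinearMap.coe_mk, AddHom.coe_mk, Submodule.coe_sum, Submodule.coe_smul,
    smul_eq_mul, mul_assoc]
  simp

theorem IsKoszulFace.of_insert (hQ : ∀ m m', Q m → m ≤ m' → Q m') {γ : σ →₀ ℕ} {τ : Finset σ}
    {v : σ} (h : IsKoszulFace Q γ (insert v τ)) : IsKoszulFace Q γ τ := by
  have hle : faceExponent τ ≤ faceExponent (insert v τ) := by
    intro w
    rw [faceExponent_apply, faceExponent_apply]
    by_cases hw : w ∈ τ <;> simp [hw]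
  exact ⟨hle.trans h.1, hQ _ _ h.2 (tsub_le_tsub_left hle γ)⟩

/-- Upward closure of `Q` makes the Koszul faces closed under deletion, so nothing maps into a
non-face; the support condition on `c` kills the terms coming from non-faces. -/
theorem koszulD_multigradedChain (hI : ∀ f, f ∈ I ↔ ∀ m ∈ f.support, Q m)
    (hQ : ∀ m m', Q m → m ≤ m' → Q m') (γ : σ →₀ ℕ) {i : ℕ} {c : Finset σ → k}
    (hc : c ∈ simplicialChains k (IsKoszulFace Q γ) i) :
    koszulD (k := k) (multigradedChain hI γ c) = multigradedChain hI γ (simplicialD k c) := by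
  funext τ
  apply Subtype.ext
  rw [coe_koszulD]
  by_cases h : IsKoszulFace Q γ τ
  · rw [multigradedChain_of_face hI _ h, simplicialD_apply, map_sum]
    refine sum_congr rfl fun v hv => ?_
    have hv' : v ∉ τ := by simpa using hv
    by_cases h' : IsKoszulFace Q γ (insert v τ)
    · have e : Finsupp.single v 1 + (γ - faceExponent (insert v τ)) = γ - faceExponent τ := by
        have := h'.1
        rw [faceExponent_insert hv'] at this ⊢
        ext w
        have hw := this w
        simp only [Finsupp.add_apply, Finsupp.coe_tsub, Pi.sub_apply] at hw ⊢
        omega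
      rw [multigradedChain_of_face hI _ h', MvPolynomial.X, MvPolynomial.monomial_mul, one_mul,
        MvPolynomial.C_mul_monomial, e]
    · have h0 : c (insert v τ) = 0 := by
        by_contra h0
        exact h' (hc _ h0).1
      rw [multigradedChain_of_not_face hI _ h', h0]
      simp
  · rw [multigradedChain_of_not_face hI _ h]
    refine sum_eq_zero fun v _ => ?_
    rw [multigradedChain_of_not_face hI _ fun h' => h (h'.of_insert hQ)]
    simp

open Classical in
/-- The coefficients of a chain in multidegree `γ`. -/
noncomputable def multidegreePart (γ : σ →₀ ℕ) (z : Finset σ → I) (τ : Finset σ) : k :=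
  if faceExponent τ ≤ γ then (z τ : MvPolynomial σ k).coeff (γ - faceExponent τ) else 0

theorem multidegreePart_mem (hI : ∀ f, f ∈ I ↔ ∀ m ∈ f.support, Q m) (γ : σ →₀ ℕ) {i : ℕ} {j : ℤ}
    {z : Finset σ → I} (hz : z ∈ koszulChains (idealGrading I) i j) :
    multidegreePart γ z ∈ simplicialChains k (IsKoszulFace Q γ) i := by
  intro τ hτ
  rw [multidegreePart] at hτ
  split_ifs at hτ with h
  · refine ⟨⟨h, (hI _).1 (z τ).2 _ (MvPolynomial.mem_support_iff.2 hτ)⟩, ?_⟩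
    by_contra hne
    rw [(hz τ).2 hne] at hτ
    simp at hτ
  · exact absurd rfl hτ

theorem simplicialD_multidegreePart (γ : σ →₀ ℕ) {z : Finset σ → I}
    (hz : koszulD (k := k) z = 0) : simplicialD k (multidegreePart γ z) = 0 := by
  funext τ
  rw [simplicialD_apply, Pi.zero_apply]
  by_cases h : faceExponent τ ≤ γ
  · have h1 := congrArg (MvPolynomial.coeff (γ - faceExponent τ))
      (congrArg (Subtype.val) (congrFun hz τ))
    rw [coe_koszulD, MvPolynomial.coeff_sum] at h1
    refine Eq.trans (sum_congr rfl fun v hv => ?_) (h1.trans (by simp))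
    have hv' : v ∉ τ := by simpa using hv
    rw [MvPolynomial.coeff_C_mul, MvPolynomial.coeff_X_mul', multidegreePart]
    congr 1
    have hiff : faceExponent (insert v τ) ≤ γ ↔ v ∈ (γ - faceExponent τ).support := by
      rw [faceExponent_insert hv', Finsupp.mem_support_iff, Finsupp.coe_tsub, Pi.sub_apply,
        faceExponent_apply, if_neg hv', tsub_zero]
      constructor
      · intro h'
        have := h' v
        rw [Finsupp.add_apply, Finsupp.single_eq_same] at this
        omega
      · intro h' w
        rw [Finsupp.add_apply, Finsupp.single_apply]
        have := h w
        split_ifs with hw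
        · subst hw
          rw [faceExponent_apply, if_neg hv']
          omega
        · simpa using this
    by_cases h' : faceExponent (insert v τ) ≤ γ
    · rw [if_pos h', if_pos (hiff.1 h'), faceExponent_insert hv', tsub_add_eq_tsub_tsub]
    · rw [if_neg h', if_neg fun h'' => h' (hiff.2 h'')]
  · refine sum_eq_zero fun v hv => ?_
    have hv' : v ∉ τ := by simpa using hv
    rw [multidegreePart, if_neg, mul_zero]
    intro h'
    rw [faceExponent_insert hv'] at h'
    exact h (le_trans le_self_add h')

/-- The monomial `m` in the component at `τ` belongs to the single multidegree `m + faceExponent τ`,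
of total degree `j`; this makes the sum finite. -/
theorem eq_sum_multigradedChain (hI : ∀ f, f ∈ I ↔ ∀ m ∈ f.support, Q m) {i : ℕ} {j : ℤ}
    {z : Finset σ → I} (hz : z ∈ koszulChains (idealGrading I) i j) :
    z = ∑ γ ∈ finsuppAntidiag univ j.toNat, multigradedChain hI γ (multidegreePart γ z) := by
  classical
  funext τ
  apply Subtype.ext
  rw [Finset.sum_apply, Submodule.coe_sum]
  ext m
  rw [MvPolynomial.coeff_sum]
  have hterm : ∀ γ : σ →₀ ℕ,
      (multigradedChain hI γ (multidegreePart γ z) τ : MvPolynomial σ k).coeff m =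
        if γ = m + faceExponent τ then (z τ : MvPolynomial σ k).coeff m else 0 := by
    intro γ
    by_cases h : faceExponent τ ≤ γ
    · have hiff : γ - faceExponent τ = m ↔ γ = m + faceExponent τ :=
        tsub_eq_iff_eq_add_of_le h
      have hval : (multigradedChain hI γ (multidegreePart γ z) τ : MvPolynomial σ k) =
          MvPolynomial.monomial (γ - faceExponent τ)
            ((z τ : MvPolynomial σ k).coeff (γ - faceExponent τ)) := by
        by_cases hf : IsKoszulFace Q γ τ
        · rw [multigradedChain_of_face hI _ hf, multidegreePart, if_pos h]
        · have h0 : (z τ : MvPolynomial σ k).coeff (γ - faceExponent τ) = 0 := by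
            by_contra h0
            exact hf ⟨h, (hI _).1 (z τ).2 _ (MvPolynomial.mem_support_iff.2 h0)⟩
          rw [multigradedChain_of_not_face hI _ hf, h0]
          simp
      rw [hval, MvPolynomial.coeff_monomial]
      by_cases hγ : γ = m + faceExponent τ
      · rw [if_pos (hiff.2 hγ), if_pos hγ, hiff.2 hγ]
      · rw [if_neg fun h' => hγ (hiff.1 h'), if_neg hγ]
    · rw [multigradedChain_of_not_face hI _ fun hf => h hf.1, if_neg]
      · simp
      · rintro rfl
        exact h le_add_self
  rw [sum_congr rfl fun γ _ => hterm γ, sum_ite_eq']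
  split_ifs with hmem
  · rfl
  · by_contra h0
    refine hmem ?_
    have hcard : τ.card = i := by
      by_contra hne
      rw [(hz τ).2 hne] at h0
      simp at h0
    have hdeg := (hz τ).1 hcard m (MvPolynomial.mem_support_iff.2 h0)
    rw [mem_finsuppAntidiag]
    refine ⟨?_, subset_univ _⟩
    have h1 : (m + faceExponent τ).degree = m.degree + τ.card := by
      rw [map_add, degree_faceExponent]
    rw [Finsupp.degree_eq_sum] at h1
    rw [h1]
    omega

theorem multigradedChain_mem (hI : ∀ f, f ∈ I ↔ ∀ m ∈ f.support, Q m) {γ : σ →₀ ℕ} {i : ℕ}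
    {c : Finset σ → k} (hc : c ∈ simplicialChains k (IsKoszulFace Q γ) i) :
    multigradedChain hI γ c ∈ koszulChains (idealGrading I) i γ.degree := by
  refine fun τ => ⟨fun hτ => ?_, fun hτ => ?_⟩
  · intro m hm
    by_cases h : IsKoszulFace Q γ τ
    · rw [multigradedChain_of_face hI _ h] at hm
      rw [mem_singleton.1 (MvPolynomial.support_monomial_subset hm)]
      have h1 := congrArg Finsupp.degree (tsub_add_cancel_of_le h.1)
      rw [map_add, degree_faceExponent] at h1
      omega
    · rw [multigradedChain_of_not_face hI _ h] at hm
      simp at hm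
  · by_cases h : IsKoszulFace Q γ τ
    · apply Subtype.ext
      rw [multigradedChain_of_face hI _ h]
      have : c τ = 0 := by
        by_contra h0
        exact hτ (hc τ h0).2
      simp [this]
    · exact multigradedChain_of_not_face hI _ h

/-- A graded component of `Tor` of a monomial ideal vanishes if the upper Koszul complexes in all
multidegrees of the given total degree are acyclic. -/
theorem subsingleton_gradedTor (hI : ∀ f, f ∈ I ↔ ∀ m ∈ f.support, Q m)
    (hQ : ∀ m m', Q m → m ≤ m' → Q m') (i : ℕ) (j : ℤ)
    (H : ∀ γ : σ →₀ ℕ, (γ.degree : ℤ) = j → IsAcyclicAt k (IsKoszulFace Q γ) i) :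
    Subsingleton (GradedTor (σ := σ) (idealGrading I) i j) := by
  refine Submodule.Quotient.subsingleton_iff.2 ?_
  rw [Submodule.submoduleOf, ← top_le_iff, ← Submodule.map_le_iff_le_comap, Submodule.map_subtype_top]
  rintro z ⟨hz, hdz⟩
  replace hdz : koszulD (k := k) z = 0 := hdz
  -- For negative `j` the truncation `j.toNat` is `0`, not the degree; here chains vanish anyway.
  rcases lt_or_ge j 0 with hj | hj
  · have h0 : z = 0 := by
      funext τ
      by_cases hcard : τ.card = i
      · apply Subtype.ext
        by_contra hne
        obtain ⟨m, hm⟩ := MvPolynomial.support_nonempty.2 hne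
        have := (hz τ).1 hcard m hm
        omega
      · exact (hz τ).2 hcard
    rw [h0]
    exact zero_mem _
  rw [eq_sum_multigradedChain hI hz]
  refine sum_mem fun γ hγ => ?_
  have hdeg : (γ.degree : ℤ) = j := by
    rw [mem_finsuppAntidiag] at hγ
    rw [Finsupp.degree_eq_sum, hγ.1, Int.toNat_of_nonneg hj]
  obtain ⟨b, hb, hbz⟩ := H γ hdeg _ (multidegreePart_mem hI γ hz) (simplicialD_multidegreePart γ hdz)
  refine ⟨multigradedChain hI γ b, ?_, ?_⟩
  · rw [← hdeg]
    exact multigradedChain_mem hI hb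
  · rw [LinearMap.restrictScalars_apply, koszulD_multigradedChain hI hQ γ hb, hbz]

/-- A monomial of an ideal none of whose proper divisors lies in the ideal contributes to
`Tor` in homological degree `0`. -/
theorem nontrivial_gradedTor_zero (hI : ∀ f, f ∈ I ↔ ∀ m ∈ f.support, Q m) {γ : σ →₀ ℕ}
    (hγ : Q γ) (hmin : ∀ v, γ v ≠ 0 → ¬Q (γ - Finsupp.single v 1)) :
    Nontrivial (GradedTor (σ := σ) (idealGrading I) 0 γ.degree) := by
  classical
  rw [← not_subsingleton_iff_nontrivial]
  intro hsub
  have hle := Submodule.Quotient.subsingleton_iff.1 hsub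
  rw [Submodule.submoduleOf, ← top_le_iff, ← Submodule.map_le_iff_le_comap,
    Submodule.map_subtype_top] at hle
  have hmem : (MvPolynomial.monomial γ 1 : MvPolynomial σ k) ∈ I := (hI _).2 fun m hm => by
    rw [mem_singleton.1 (MvPolynomial.support_monomial_subset hm)]
    exact hγ
  let z : Finset σ → I := fun τ => if τ = ∅ then ⟨_, hmem⟩ else 0
  have hz : z ∈ koszulCycles (idealGrading I) 0 γ.degree := by
    refine ⟨fun τ => ⟨fun hτ => ?_, fun hτ => ?_⟩, ?_⟩
    · intro m hm
      simp only [z, if_pos (card_eq_zero.1 hτ)] at hm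
      rw [mem_singleton.1 (MvPolynomial.support_monomial_subset hm)]
      simp
    · exact if_neg fun h => hτ (card_eq_zero.2 h)
    · change koszulD (k := k) z = 0
      funext τ
      exact sum_eq_zero fun v _ => by simp [z]
  obtain ⟨b, hb, hbz⟩ := hle hz
  -- In a boundary, the coefficient at `γ` is built from coefficients of elements of `I` at `γ -
  -- e_v`, all zero by minimality.
  have h1 := congrArg (MvPolynomial.coeff γ) (congrArg Subtype.val (congrFun hbz ∅))
  rw [LinearMap.restrictScalars_apply, coe_koszulD, MvPolynomial.coeff_sum] at h1
  simp only [z, if_true, MvPolynomial.coeff_monomial] at h1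
  refine one_ne_zero (h1.symm.trans (sum_eq_zero fun v _ => ?_))
  rw [MvPolynomial.coeff_C_mul, MvPolynomial.coeff_X_mul']
  split_ifs with hv
  · have : (b (insert v ∅) : MvPolynomial σ k).coeff (γ - Finsupp.single v 1) = 0 := by
      by_contra h0
      exact hmin v (Finsupp.mem_support_iff.1 hv)
        ((hI _).1 (b (insert v ∅)).2 _ (MvPolynomial.mem_support_iff.2 h0))
    rw [this, mul_zero]
  · rw [mul_zero]

end MonomialIdeals

/-! ### Upper Koszul complexes of powers of cover ideals -/

section CoverComplexes

variable {V : Type*} [Fintype V] [DecidableEq V] {G : SimpleGraph V} {s : ℕ} {γ : V →₀ ℕ}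

theorem isKoszulFace_cover_iff {τ : Finset V} :
    IsKoszulFace (IsCoverExponent G s) γ τ ↔ (∀ v ∈ τ, 1 ≤ γ v) ∧
      ∀ ⦃u w⦄, G.Adj u w → s + (if u ∈ τ then 1 else 0) + (if w ∈ τ then 1 else 0) ≤ γ u + γ w := by
  have hle : faceExponent τ ≤ γ ↔ ∀ v ∈ τ, 1 ≤ γ v := by
    rw [Finsupp.le_def]
    refine forall_congr' fun v => ?_
    rw [faceExponent_apply]
    by_cases hv : v ∈ τ <;> simp [hv]
  rw [IsKoszulFace, ← hle]
  refine and_congr_right fun h => forall₂_congr fun u w => forall_congr' fun _ => ?_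
  have hu := h u
  have hw := h w
  rw [Finsupp.coe_tsub, Pi.sub_apply, Pi.sub_apply]
  rw [faceExponent_apply] at hu hw ⊢
  rw [faceExponent_apply]
  omega

theorem isCoverExponent_of_face {τ : Finset V}
    (h : IsKoszulFace (IsCoverExponent G s) γ τ) : IsCoverExponent G s γ := by
  rw [isKoszulFace_cover_iff] at h
  intro u w huw
  have := h.2 huw
  omega

theorem isKoszulFace_singleton_iff {v : V} (hγ : IsCoverExponent G s γ) :
    IsKoszulFace (IsCoverExponent G s) γ {v} ↔
      1 ≤ γ v ∧ ∀ w, G.Adj v w → s + 1 ≤ γ v + γ w := by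
  rw [isKoszulFace_cover_iff]
  simp only [mem_singleton, forall_eq]
  refine and_congr_right fun _ => ⟨fun h w hw => ?_, fun h u w huw => ?_⟩
  · have := h hw
    rw [if_pos rfl] at this
    omega
  · have h1 := hγ huw
    have := huw.ne
    by_cases hu : u = v
    · subst hu
      have := h w huw
      rw [if_pos rfl, if_neg huw.ne']
      omega
    · by_cases hw : w = v
      · subst hw
        have := h u huw.symm
        rw [if_neg hu, if_pos rfl]
        omega
      · rw [if_neg hu, if_neg hw]
        omega

theorem isKoszulFace_pair {u v : V} (hu : IsKoszulFace (IsCoverExponent G s) γ {u})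
    (hv : IsKoszulFace (IsCoverExponent G s) γ {v}) (h : G.Adj u v → s + 2 ≤ γ u + γ v) :
    IsKoszulFace (IsCoverExponent G s) γ {u, v} := by
  rw [isKoszulFace_cover_iff] at hu hv ⊢
  simp only [mem_singleton, mem_insert, forall_eq_or_imp, forall_eq] at hu hv ⊢
  refine ⟨⟨hu.1, hv.1⟩, fun a b hab => ?_⟩
  have h1 := hu.2 hab
  have h2 := hv.2 hab
  have hne := hab.ne
  by_cases hau : a = u <;> by_cases hav : a = v <;> by_cases hbu : b = u <;>
    by_cases hbv : b = v <;> simp only [hau, hav, hbu, hbv, true_or, or_true, or_self, if_true,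
      if_false] at h1 h2 ⊢ <;> try omega
  all_goals first
    | exact absurd (hau.trans hbu.symm) hne
    | exact absurd (hav.trans hbv.symm) hne
    | exact h (hau ▸ hbv ▸ hab)
    | exact (add_comm (γ u) (γ v)) ▸ h (hav ▸ hbu ▸ hab.symm)

/-- A vertex whose weight can be lowered independently of all other vertices. -/
def IsFreeVertex {V : Type*} (G : SimpleGraph V) (s : ℕ) (γ : V →₀ ℕ) (v : V) : Prop :=
  1 ≤ γ v ∧ ∀ w, G.Adj v w → s + 2 ≤ γ v + γ w ∨ γ w = 0 ∧ s + 1 ≤ γ v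

/-- Adding `v` needs slack two only on edges to a neighbour already in `τ`, whose weight is then
positive; this rules out the second alternative in the definition. -/
theorem IsFreeVertex.isKoszulFace_insert {v : V} (hv : IsFreeVertex G s γ v) {τ : Finset V}
    (h : IsKoszulFace (IsCoverExponent G s) γ τ) :
    IsKoszulFace (IsCoverExponent G s) γ (insert v τ) := by
  rw [isKoszulFace_cover_iff] at h ⊢
  have key : ∀ w, G.Adj v w → s + 1 + (if w ∈ τ then 1 else 0) ≤ γ v + γ w := by
    intro w hw
    split_ifs with hwτ
    · have := h.1 w hwτ
      have := hv.2 w hw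
      omega
    · have := hv.2 w hw
      omega
  refine ⟨fun w hw => ?_, fun u w huw => ?_⟩
  · rcases mem_insert.1 hw with rfl | hw
    · exact hv.1
    · exact h.1 w hw
  · by_cases hu : u = v
    · subst hu
      simpa [huw.ne'] using key w huw
    · by_cases hw : w = v
      · subst hw
        have := key u huw.symm
        simp only [mem_insert, huw.ne, false_or, true_or, if_true]
        omega
      · simpa [hu, hw] using h.2 huw

theorem le_of_not_isFreeVertex {V : Type*} {G : SimpleGraph V} {s : ℕ} {γ : V →₀ ℕ} {v : V} (hv : ¬IsFreeVertex G s γ v) : γ v ≤ s := by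
  by_contra! h
  refine hv ⟨by omega, fun w _ => ?_⟩
  omega

theorem exists_adj_add_le_succ {V : Type*} {G : SimpleGraph V} {s : ℕ} {γ : V →₀ ℕ}
    (hfree : ∀ v, ¬IsFreeVertex G s γ v) {v : V}
    (hv : ∃ w, G.Adj v w) : ∃ w, G.Adj v w ∧ γ v + γ w ≤ s + 1 := by
  by_cases h0 : γ v = 0
  · obtain ⟨w, hw⟩ := hv
    exact ⟨w, hw, by have := le_of_not_isFreeVertex (hfree w); omega⟩
  · by_contra! h
    refine hfree v ⟨by omega, fun w hw => ?_⟩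
    have := h w hw
    omega

theorem exists_adj_add_le (hγ : IsCoverExponent G s γ) (hfree : ∀ v, ¬IsFreeVertex G s γ v) {v : V}
    (hv : ∃ w, G.Adj v w) (hF : ¬IsKoszulFace (IsCoverExponent G s) γ {v}) :
    ∃ w, G.Adj v w ∧ γ v + γ w ≤ s := by
  by_cases h0 : γ v = 0
  · obtain ⟨w, hw⟩ := hv
    exact ⟨w, hw, by have := le_of_not_isFreeVertex (hfree w); omega⟩
  · by_contra! h
    rw [isKoszulFace_singleton_iff hγ] at hF
    exact hF ⟨by omega, fun w hw => by have := h w hw; omega⟩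

end CoverComplexes

/-! ### The crown graph -/

section CrownGraph

variable {n : ℕ}

theorem crown_vertex_cases (v : Fin n ⊕ₗ Fin n) :
    (∃ i, v = Sum.inlₗ i) ∨ ∃ j, v = Sum.inrₗ j := by
  rcases h : ofLex v with i | j
  · exact Or.inl ⟨i, h⟩
  · exact Or.inr ⟨j, h⟩

theorem inl_inj {i j : Fin n} : (Sum.inlₗ i : Fin n ⊕ₗ Fin n) = Sum.inlₗ j ↔ i = j :=
  ⟨fun h => Sum.inl_injective (toLex.injective h), fun h => by rw [h]⟩

theorem inr_inj {i j : Fin n} : (Sum.inrₗ i : Fin n ⊕ₗ Fin n) = Sum.inrₗ j ↔ i = j :=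
  ⟨fun h => Sum.inr_injective (toLex.injective h), fun h => by rw [h]⟩

theorem inl_ne_inr {i j : Fin n} : (Sum.inlₗ i : Fin n ⊕ₗ Fin n) ≠ Sum.inrₗ j :=
  fun h => Sum.inl_ne_inr (toLex.injective h)

theorem crownGraph_adj_inl_inr {i j : Fin n} :
    (crownGraph n).Adj (Sum.inlₗ i) (Sum.inrₗ j) ↔ i ≠ j := by
  constructor
  · rintro ⟨a, b, hab, ⟨h1, h2⟩ | ⟨h1, h2⟩⟩
    · rwa [inl_inj.1 h1, inr_inj.1 h2]
    · exact absurd h1.symm inl_ne_inr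
  · exact fun h => ⟨i, j, h, Or.inl ⟨rfl, rfl⟩⟩

theorem crownGraph_adj_inl {i : Fin n} {w : Fin n ⊕ₗ Fin n} :
    (crownGraph n).Adj (Sum.inlₗ i) w ↔ ∃ j, i ≠ j ∧ w = Sum.inrₗ j := by
  constructor
  · rintro ⟨a, b, hab, ⟨h1, h2⟩ | ⟨h1, h2⟩⟩
    · exact ⟨b, by rwa [inl_inj.1 h1], h2⟩
    · exact absurd h2 inl_ne_inr
  · rintro ⟨j, h, rfl⟩
    exact crownGraph_adj_inl_inr.2 h

theorem crownGraph_adj_inr {j : Fin n} {w : Fin n ⊕ₗ Fin n} :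
    (crownGraph n).Adj (Sum.inrₗ j) w ↔ ∃ i, i ≠ j ∧ w = Sum.inlₗ i := by
  constructor
  · rintro ⟨a, b, hab, ⟨h1, h2⟩ | ⟨h1, h2⟩⟩
    · exact absurd h1.symm inl_ne_inr
    · exact ⟨a, by rwa [inr_inj.1 h2], h1⟩
  · rintro ⟨i, h, rfl⟩
    exact (crownGraph_adj_inl_inr.2 h).symm

/-- The bipartition of the crown graph. -/
def crownColoring (n : ℕ) : (crownGraph n).Coloring Bool :=
  SimpleGraph.Coloring.mk (fun v => (ofLex v).isLeft) (by
    rintro u v ⟨i, j, _, ⟨rfl, rfl⟩ | ⟨rfl, rfl⟩⟩ <;> simp [Sum.inlₗ, Sum.inrₗ])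

theorem sum_crown (f : Fin n ⊕ₗ Fin n → ℕ) :
    ∑ v, f v = ∑ i, f (Sum.inlₗ i) + ∑ j, f (Sum.inrₗ j) := by
  rw [← Equiv.sum_comp toLex f, Fintype.sum_sum_type]

theorem sum_add_two_mul_le {f : Fin n → ℕ} {s : ℕ} (hf : ∀ i, f i ≤ s) {i k : Fin n}
    (hik : i ≠ k) : ∑ l, f l + 2 * s ≤ f i + f k + n * s := by
  have h1 : ∑ l ∈ ({i, k} : Finset (Fin n)), s + ∑ l ∈ ({i, k} : Finset (Fin n))ᶜ, s = n * s := by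
    rw [sum_add_sum_compl, sum_const, card_univ, Fintype.card_fin, smul_eq_mul]
  have h2 := sum_add_sum_compl ({i, k} : Finset (Fin n)) f
  have h3 : ∑ l ∈ ({i, k} : Finset (Fin n))ᶜ, f l ≤ ∑ l ∈ ({i, k} : Finset (Fin n))ᶜ, s :=
    sum_le_sum fun l _ => hf l
  rw [sum_pair hik] at h1 h2
  omega

/-- The other `2n - 4` weights are bounded by `s`; the terms are moved across to avoid subtraction.
-/
theorem degree_add_le {γ : (Fin n ⊕ₗ Fin n) →₀ ℕ} {s : ℕ} (hγ : ∀ v, γ v ≤ s) {i k j l : Fin n}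
    (hik : i ≠ k) (hjl : j ≠ l) :
    γ.degree + 4 * s ≤ (γ (Sum.inlₗ i) + γ (Sum.inrₗ j)) + (γ (Sum.inlₗ k) + γ (Sum.inrₗ l)) +
      2 * n * s := by
  have h1 := sum_add_two_mul_le (f := fun i => γ (Sum.inlₗ i)) (fun i => hγ _) hik
  have h2 := sum_add_two_mul_le (f := fun i => γ (Sum.inrₗ i)) (fun i => hγ _) hjl
  rw [Finsupp.degree_eq_sum, sum_crown]
  have : 2 * n * s = n * s + n * s := by ring
  omega

theorem exists_crownGraph_adj (hn : 2 ≤ n) (v : Fin n ⊕ₗ Fin n) :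
    ∃ w, (crownGraph n).Adj v w := by
  have : Nontrivial (Fin n) := Fin.nontrivial_iff_two_le.2 hn
  rcases crown_vertex_cases v with ⟨i, rfl⟩ | ⟨j, rfl⟩
  · obtain ⟨j, hj⟩ := exists_ne i
    exact ⟨_, crownGraph_adj_inl_inr.2 hj.symm⟩
  · obtain ⟨i, hi⟩ := exists_ne j
    exact ⟨_, (crownGraph_adj_inl_inr.2 hi).symm⟩

/-- If some vertices of both sides lie in the complex, then the two sides are joined by an edge
of the complex. -/
theorem exists_joining_edge (hn : 2 ≤ n) {s : ℕ} {γ : (Fin n ⊕ₗ Fin n) →₀ ℕ}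
    (hγ : IsCoverExponent (crownGraph n) s γ) (hfree : ∀ v, ¬IsFreeVertex (crownGraph n) s γ v)
    (hdeg : (2 * n - 2) * s + 1 < γ.degree) {i j : Fin n}
    (hi : IsKoszulFace (IsCoverExponent (crownGraph n) s) γ {Sum.inlₗ i})
    (hj : IsKoszulFace (IsCoverExponent (crownGraph n) s) γ {Sum.inrₗ j}) :
    ∃ p q, IsKoszulFace (IsCoverExponent (crownGraph n) s) γ {Sum.inlₗ p} ∧
      IsKoszulFace (IsCoverExponent (crownGraph n) s) γ {Sum.inrₗ q} ∧
      IsKoszulFace (IsCoverExponent (crownGraph n) s) γ {Sum.inlₗ p, Sum.inrₗ q} := by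
  by_contra! hno
  -- Nonadjacent vertices of the complex always span a face, in particular `x_p` and `y_p`.
  have hsep : ∀ p q, IsKoszulFace (IsCoverExponent (crownGraph n) s) γ {Sum.inlₗ p} →
      IsKoszulFace (IsCoverExponent (crownGraph n) s) γ {Sum.inrₗ q} →
      p ≠ q ∧ γ (Sum.inlₗ p) + γ (Sum.inrₗ q) ≤ s + 1 := by
    intro p q hp hq
    by_contra! h
    refine hno p q hp hq (isKoszulFace_pair hp hq fun hadj => ?_)
    have := h (crownGraph_adj_inl_inr.1 hadj)
    omega
  have hout : ∃ v, ¬IsKoszulFace (IsCoverExponent (crownGraph n) s) γ {v} := by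
    by_contra! hall
    exact (hsep i i (hall _) (hall _)).1 rfl
  have htight : ∃ p q, p ≠ q ∧ γ (Sum.inlₗ p) + γ (Sum.inrₗ q) ≤ s := by
    obtain ⟨v, hv⟩ := hout
    obtain ⟨w, hadj, hw⟩ := exists_adj_add_le hγ hfree (exists_crownGraph_adj hn v) hv
    rcases crown_vertex_cases v with ⟨p, rfl⟩ | ⟨q, rfl⟩
    · obtain ⟨q, hpq, rfl⟩ := crownGraph_adj_inl.1 hadj
      exact ⟨p, q, hpq, hw⟩
    · obtain ⟨p, hpq, rfl⟩ := crownGraph_adj_inr.1 hadj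
      exact ⟨p, q, hpq, by omega⟩
  obtain ⟨p, q, hpq, hle⟩ := htight
  -- A vertex of the complex has slack at least one on all its edges, so the tight edge avoids `x_i`
  -- and `y_j`.
  have hip : i ≠ p := by
    rintro rfl
    have := ((isKoszulFace_singleton_iff hγ).1 hi).2 _ (crownGraph_adj_inl_inr.2 hpq)
    omega
  have hjq : j ≠ q := by
    rintro rfl
    have := ((isKoszulFace_singleton_iff hγ).1 hj).2 _ (crownGraph_adj_inl_inr.2 hpq).symm
    omega
  have h1 := degree_add_le (fun v => le_of_not_isFreeVertex (hfree v)) hip hjq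
  have h2 := (hsep i j hi hj).2
  have h3 : (2 * n - 2) * s + 2 * s = 2 * n * s := by
    rw [← add_mul]
    congr 1
    omega
  omega

/-- The multigraded pieces of the powers of the cover ideal of a crown graph have no homology
above the line of slope one through the top generator degree. -/
theorem isAcyclicAt_crown (k : Type*) [Field k] (hn : 1 ≤ n) (s : ℕ) (i : ℕ)
    (γ : (Fin n ⊕ₗ Fin n) →₀ ℕ) (hdeg : (2 * n - 2) * s + i < γ.degree) :
    IsAcyclicAt k (IsKoszulFace (IsCoverExponent (crownGraph n) s) γ) i := by
  by_cases hγ : IsCoverExponent (crownGraph n) s γ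
  swap
  · exact isAcyclicAt_of_cone (Sum.inlₗ ⟨0, hn⟩)
      (fun τ h => absurd (isCoverExponent_of_face h) hγ) i
  by_cases hfree : ∃ v, IsFreeVertex (crownGraph n) s γ v
  · obtain ⟨v, hv⟩ := hfree
    exact isAcyclicAt_of_cone v (fun τ h => hv.isKoszulFace_insert h) i
  push Not at hfree
  -- For `n = 1` there are no edges, so any vertex of positive weight is free.
  have hn2 : 2 ≤ n := by
    by_contra! hlt
    obtain ⟨v, hv⟩ : ∃ v, γ v ≠ 0 := by
      by_contra! h0
      rw [Finsupp.degree_eq_sum, sum_eq_zero fun v _ => h0 v] at hdeg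
      omega
    refine hfree v ⟨by omega, ?_⟩
    rintro w ⟨a, b, hab, -⟩
    exact absurd (Fin.ext (by omega)) hab
  have hle : ∀ v, γ v ≤ s := fun v => le_of_not_isFreeVertex (hfree v)
  have h3 : (2 * n - 2) * s + 2 * s = 2 * n * s := by
    rw [← add_mul]
    congr 1
    omega
  have hi : i < 2 := by
    have hnear : ∀ p : Fin n, ∃ q, p ≠ q ∧ γ (Sum.inlₗ p) + γ (Sum.inrₗ q) ≤ s + 1 := by
      intro p
      obtain ⟨w, hadj, hw⟩ := exists_adj_add_le_succ hfree (exists_crownGraph_adj hn2 (Sum.inlₗ p))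
      obtain ⟨q, hpq, rfl⟩ := crownGraph_adj_inl.1 hadj
      exact ⟨q, hpq, hw⟩
    -- Restarting from `x_q`, the non-neighbour of `y_q`, forces the second edge to be disjoint from
    -- the first.
    obtain ⟨q, hpq, h1⟩ := hnear ⟨0, hn⟩
    obtain ⟨l, hql, h2⟩ := hnear q
    have := degree_add_le hle hpq hql
    omega
  interval_cases i
  · obtain ⟨v, hv⟩ : ∃ v, IsKoszulFace (IsCoverExponent (crownGraph n) s) γ {v} := by
      by_contra! hno
      have htight : ∀ p : Fin n, ∃ q, p ≠ q ∧ γ (Sum.inlₗ p) + γ (Sum.inrₗ q) ≤ s := by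
        intro p
        obtain ⟨w, hadj, hw⟩ :=
          exists_adj_add_le hγ hfree (exists_crownGraph_adj hn2 (Sum.inlₗ p)) (hno _)
        obtain ⟨q, hpq, rfl⟩ := crownGraph_adj_inl.1 hadj
        exact ⟨q, hpq, hw⟩
      obtain ⟨q, hpq, h1⟩ := htight ⟨0, hn⟩
      obtain ⟨l, hql, h2⟩ := htight q
      have := degree_add_le hle hpq hql
      omega
    exact isAcyclicAt_zero hv
  · have hll : ∀ p q, IsKoszulFace (IsCoverExponent (crownGraph n) s) γ {Sum.inlₗ p} →
        IsKoszulFace (IsCoverExponent (crownGraph n) s) γ {Sum.inlₗ q} →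
        IsKoszulFace (IsCoverExponent (crownGraph n) s) γ {Sum.inlₗ p, Sum.inlₗ q} := by
      intro p q hp hq
      refine isKoszulFace_pair hp hq fun hadj => ?_
      obtain ⟨l, -, hl⟩ := crownGraph_adj_inl.1 hadj
      exact absurd hl inl_ne_inr
    have hrr : ∀ p q, IsKoszulFace (IsCoverExponent (crownGraph n) s) γ {Sum.inrₗ p} →
        IsKoszulFace (IsCoverExponent (crownGraph n) s) γ {Sum.inrₗ q} →
        IsKoszulFace (IsCoverExponent (crownGraph n) s) γ {Sum.inrₗ p, Sum.inrₗ q} := by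
      intro p q hp hq
      refine isKoszulFace_pair hp hq fun hadj => ?_
      obtain ⟨l, -, hl⟩ := crownGraph_adj_inr.1 hadj
      exact absurd hl.symm inl_ne_inr
    have hlr : ∀ p q, IsKoszulFace (IsCoverExponent (crownGraph n) s) γ {Sum.inlₗ p} →
        IsKoszulFace (IsCoverExponent (crownGraph n) s) γ {Sum.inrₗ q} →
        Relation.ReflTransGen
          (fun a b => IsKoszulFace (IsCoverExponent (crownGraph n) s) γ {a, b})
          (Sum.inlₗ p) (Sum.inrₗ q) := by
      intro p q hp hq
      obtain ⟨p', q', hp', hq', hpq'⟩ := exists_joining_edge hn2 hγ hfree hdeg hp hq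
      exact .tail (.tail (.single (hll p p' hp hp')) hpq') (hrr q' q hq' hq)
    refine isAcyclicAt_one fun u w hu hw => ?_
    rcases crown_vertex_cases u with ⟨p, rfl⟩ | ⟨p, rfl⟩ <;>
      rcases crown_vertex_cases w with ⟨q, rfl⟩ | ⟨q, rfl⟩
    · exact .single (hll p q hu hw)
    · exact hlr p q hu hw
    · exact (@Relation.ReflTransGen.stdSymm _ _ ⟨fun a b h => by rwa [pair_comm]⟩).symm _ _
        (hlr q p hw hu)
    · exact .single (hrr p q hu hw)

theorem card_le_of_isMinimalVertexCover {C : Finset (Fin n ⊕ₗ Fin n)} (hn : 1 ≤ n)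
    (hC : IsMinimalVertexCover (crownGraph n) C) : C.card ≤ 2 * n - 2 := by
  -- By minimality, deleting `v ∈ C` uncovers an edge at `v`.
  have hout : ∀ v, v ∉ C ∨ ∃ w, (crownGraph n).Adj v w ∧ w ∉ C := by
    intro v
    by_contra! h
    refine hC.not_prop_of_lt (erase_ssubset h.1) fun a b hab => ?_
    have := hC.prop hab
    rw [mem_coe, mem_coe] at this
    rw [mem_coe, mem_coe, mem_erase, mem_erase]
    by_cases ha : a = v
    · subst ha
      exact Or.inr ⟨hab.ne', h.2 b hab⟩
    · by_cases hb : b = v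
      · subst hb
        exact Or.inl ⟨hab.ne, h.2 a hab.symm⟩
      · exact this.imp (fun h => ⟨ha, h⟩) fun h => ⟨hb, h⟩
  obtain ⟨u, w, huw, hu, hw⟩ : ∃ u w, u ≠ w ∧ u ∉ C ∧ w ∉ C := by
    have hl : ∀ p : Fin n, Sum.inlₗ p ∉ C ∨ ∃ q, p ≠ q ∧ Sum.inrₗ q ∉ C := by
      intro p
      refine (hout (Sum.inlₗ p)).imp id ?_
      rintro ⟨w, hadj, hw⟩
      obtain ⟨q, hpq, rfl⟩ := crownGraph_adj_inl.1 hadj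
      exact ⟨q, hpq, hw⟩
    rcases hl ⟨0, hn⟩ with h | ⟨q, hq, h⟩
    · rcases hout (Sum.inrₗ ⟨0, hn⟩) with h' | ⟨w, hadj, h'⟩
      · exact ⟨_, _, inl_ne_inr, h, h'⟩
      · obtain ⟨p, hp, rfl⟩ := crownGraph_adj_inr.1 hadj
        exact ⟨_, _, fun e => hp (inl_inj.1 e), h', h⟩
    · rcases hl q with h' | ⟨l, hl, h'⟩
      · exact ⟨_, _, inl_ne_inr, h', h⟩
      · exact ⟨_, _, fun e => hl (inr_inj.1 e), h, h'⟩
  have h1 : C ⊆ (({u, w} : Finset (Fin n ⊕ₗ Fin n))ᶜ) := by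
    intro v hv
    rw [mem_compl, mem_insert, mem_singleton]
    rintro (rfl | rfl)
    · exact hu hv
    · exact hw hv
  have h2 := card_le_card h1
  have h3 : Fintype.card (Fin n ⊕ₗ Fin n) = 2 * n := by
    rw [show Fintype.card (Fin n ⊕ₗ Fin n) = Fintype.card (Fin n ⊕ Fin n) from
      Fintype.card_congr ofLex, Fintype.card_sum, Fintype.card_fin, two_mul]
  rwa [card_compl, card_pair huw, h3] at h2

theorem coverDegree_crownGraph (hn : 1 ≤ n) : coverDegree (crownGraph n) = 2 * n - 2 := by
  refine IsGreatest.csSup_eq ⟨?_, ?_⟩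
  · have hmem : ∀ v : Fin n ⊕ₗ Fin n,
        v ∈ ({Sum.inlₗ ⟨0, hn⟩, Sum.inrₗ ⟨0, hn⟩} : Finset (Fin n ⊕ₗ Fin n))ᶜ ↔
          v ≠ Sum.inlₗ ⟨0, hn⟩ ∧ v ≠ Sum.inrₗ ⟨0, hn⟩ := by
      intro v
      rw [mem_compl, mem_insert, mem_singleton, not_or]
    refine ⟨({Sum.inlₗ ⟨0, hn⟩, Sum.inrₗ ⟨0, hn⟩} : Finset (Fin n ⊕ₗ Fin n))ᶜ, ⟨?_, ?_⟩, ?_⟩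
    · have key : ∀ i j : Fin n, i ≠ j → (Sum.inlₗ i : Fin n ⊕ₗ Fin n) ∈
          ({Sum.inlₗ ⟨0, hn⟩, Sum.inrₗ ⟨0, hn⟩} : Finset (Fin n ⊕ₗ Fin n))ᶜ ∨
          (Sum.inrₗ j : Fin n ⊕ₗ Fin n) ∈
          ({Sum.inlₗ ⟨0, hn⟩, Sum.inrₗ ⟨0, hn⟩} : Finset (Fin n ⊕ₗ Fin n))ᶜ := by
        intro i j hij
        rw [hmem, hmem]
        by_cases hi : i = ⟨0, hn⟩
        · exact Or.inr ⟨inl_ne_inr.symm, fun h => hij (hi.trans (inr_inj.1 h).symm)⟩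
        · exact Or.inl ⟨fun h => hi (inl_inj.1 h), inl_ne_inr⟩
      rintro u v ⟨i, j, hij, ⟨rfl, rfl⟩ | ⟨rfl, rfl⟩⟩
      · simpa only [mem_coe] using key i j hij
      · simpa only [mem_coe] using (key i j hij).symm
    · intro D hD hle v hv
      have h0l : Sum.inlₗ ⟨0, hn⟩ ∉ D := fun h => ((hmem _).1 (hle h)).1 rfl
      have h0r : Sum.inrₗ ⟨0, hn⟩ ∉ D := fun h => ((hmem _).1 (hle h)).2 rfl
      rw [hmem] at hv
      rcases crown_vertex_cases v with ⟨i, rfl⟩ | ⟨j, rfl⟩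
      · exact (hD (crownGraph_adj_inl_inr.2 fun h => hv.1 (inl_inj.2 h))).resolve_right h0r
      · exact (hD (crownGraph_adj_inl_inr.2 fun h => hv.2 (inr_inj.2 h.symm))).resolve_left h0l
    · rw [card_compl, card_pair inl_ne_inr,
        show Fintype.card (Fin n ⊕ₗ Fin n) = Fintype.card (Fin n ⊕ Fin n) from
          Fintype.card_congr ofLex, Fintype.card_sum, Fintype.card_fin, two_mul]
  · rintro _ ⟨C, hC, rfl⟩
    exact card_le_of_isMinimalVertexCover hn hC

theorem hasRegularity_crown (k : Type*) [Field k] (hn : 1 ≤ n) (s : ℕ) :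
    HasRegularity (σ := Fin n ⊕ₗ Fin n) (idealGrading (coverIdeal k (crownGraph n) ^ s))
      ((s * (2 * n - 2) : ℕ) : ℤ) := by
  have hI : ∀ f, f ∈ coverIdeal k (crownGraph n) ^ s ↔
      ∀ m ∈ f.support, IsCoverExponent (crownGraph n) s m :=
    fun f => mem_coverIdeal_pow_iff (crownColoring n)
  constructor
  -- `γ` is `s` times the indicator of a largest minimal cover. Lowering the weight at `v` breaks
  -- the edge from `v` to the omitted vertex on the other side, of weight zero.
  · let γ : (Fin n ⊕ₗ Fin n) →₀ ℕ := Finsupp.equivFunOnFinite.symm fun v =>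
      if v = Sum.inlₗ ⟨0, hn⟩ ∨ v = Sum.inrₗ ⟨0, hn⟩ then 0 else s
    have hl : ∀ i, γ (Sum.inlₗ i) = if i = ⟨0, hn⟩ then 0 else s := fun i => by
      simp [γ]
    have hr : ∀ i, γ (Sum.inrₗ i) = if i = ⟨0, hn⟩ then 0 else s := fun i => by
      simp [γ]
    have hdeg : γ.degree = s * (2 * n - 2) := by
      rw [Finsupp.degree_eq_sum, sum_crown]
      simp only [hl, hr, sum_ite, sum_const_zero, sum_const, zero_add, smul_eq_mul]
      rw [filter_ne', card_erase_of_mem (mem_univ _), card_univ, Fintype.card_fin, ← add_mul,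
        mul_comm]
      congr 1
      omega
    refine ⟨0, γ.degree, nontrivial_gradedTor_zero hI ?_ ?_, by rw [hdeg]; simp⟩
    · have key : ∀ i j : Fin n, i ≠ j → s ≤ γ (Sum.inlₗ i) + γ (Sum.inrₗ j) := by
        intro i j hij
        rw [hl, hr]
        by_cases hi : i = ⟨0, hn⟩
        · rw [if_neg (c := j = ⟨0, hn⟩) fun h => hij (hi.trans h.symm)]
          omega
        · rw [if_neg hi]
          omega
      rintro u v ⟨i, j, hij, ⟨rfl, rfl⟩ | ⟨rfl, rfl⟩⟩
      · exact key i j hij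
      · rw [add_comm]
        exact key i j hij
    · intro v hv hQ
      rcases crown_vertex_cases v with ⟨i, rfl⟩ | ⟨j, rfl⟩
      · rw [hl] at hv
        have hi : i ≠ ⟨0, hn⟩ := fun h => hv (if_pos h)
        rw [if_neg hi] at hv
        have := hQ (crownGraph_adj_inl_inr.2 hi)
        simp only [Finsupp.coe_tsub, Pi.sub_apply, Finsupp.single_eq_same, hl, hr, if_neg hi,
          if_true] at this
        omega
      · rw [hr] at hv
        have hj : j ≠ ⟨0, hn⟩ := fun h => hv (if_pos h)
        rw [if_neg hj] at hv
        have := hQ (crownGraph_adj_inl_inr.2 hj.symm)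
        simp only [Finsupp.coe_tsub, Pi.sub_apply, Finsupp.single_eq_same, hl, hr, if_neg hj,
          if_true] at this
        omega
  · rintro _ ⟨i, j, hnt, rfl⟩
    by_contra! hlt
    refine not_subsingleton_iff_nontrivial.2 hnt (subsingleton_gradedTor hI
      (fun m m' hm hle u v huv => (hm huv).trans (add_le_add (hle u) (hle v))) i j
      fun γ hγ => isAcyclicAt_crown k hn s i γ ?_)
    rw [mul_comm]
    omega

end CrownGraph

theorem theorem3p4 (k : Type*) [Field k] (n : ℕ) (hn : 1 ≤ n) :
    coverDegree (crownGraph n) = 2 * n - 2 ∧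
    ∀ s : ℕ, 1 ≤ s →
      symbolicPower (coverIdeal k (crownGraph n)) s = coverIdeal k (crownGraph n) ^ s ∧
      HasRegularity (σ := Fin n ⊕ₗ Fin n) (idealGrading (coverIdeal k (crownGraph n) ^ s))
        ((s * coverDegree (crownGraph n) : ℕ) : ℤ) := by
  refine ⟨coverDegree_crownGraph hn, fun s _ => ⟨symbolicPower_coverIdeal (crownColoring n) s, ?_⟩⟩
  rw [coverDegree_crownGraph hn]
  exact hasRegularity_crown k hn s
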